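/- Let $S^2=\{(a,b,c)\in\mathbb{R}^3: a^2+b^2+c^2=1\}$, regarded as a subset of $\mathbb{C}^3$ via $\mathbb{R}^3\subset\mathbb{C}^3$. For $w\in\mathbb{C}^2\setminus\{0\}$ let $\rho_1(w)=[w_0,w_1]\in\mathbb{CP}^1$ be the complex line spanned by $w$, and give $\mathbb{CP}^1$ its usual (quotient) topology and complex structure. For a polynomial mapping $P=(P_0,P_1):\mathbb{C}^3\to\mathbb{C}^2$, the rational mapping $\rho_1(P)$ is the composition $\rho_1\circ P$, defined on the complement of its critical set $P^{-1}(0)$. Let $$U=\{(x,y,z)\in\mathbb{C}^3 : x^2+y^2+z^2\neq 0,\ -\pi<\arg(x^2+y^2+z^2)<\pi\},$$ and let $\sqrt{\cdot}$ denote the principal branch, so that $\sqrt1=1$. Then: 1. $S^2$ is rationally convex in $\mathbb{C}^3$: it is compact, and for every $y\in\mathbb{C}^3\setminus S^2$ there is a polynomial $p$ with $p(y)=0$ which has no zero on $S^2$. 2. $U$ is an open neighbourhood of $S^2$, and the formulas $$g(x,y,z)=\Bigl[\tfrac{x+iy}{\sqrt{x^2+y^2+z^2}+z},\,1\Bigr]\quad\text{or}\quad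 \Bigl[1,\,\tfrac{x-iy}{\sqrt{x^2+y^2+z^2}-z}\Bigr],$$ each used wherever its denominator does not vanish, give a well-defined holomorphic mapping $g:U\to\mathbb{CP}^1$ (at each point of $U$ at least one denominator is nonzero, and the formulas agree where both are). 3. The restriction $g|_{S^2}$ is stereographic projection: for $(a,b,c)\in S^2$, $g(a,b,c)=\bigl[\frac{a+ib}{1+c},1\bigr]$ if $c\ne-1$ and $g(a,b,c)=\bigl[1,\frac{a-ib}{1-c}\bigr]$ if $c\neq1$. It is a homeomorphism of $S^2$ onto $\mathbb{CP}^1$. 4. $\pi_2(S^3)=0$. For every polynomial mapping $P:\mathbb{C}^3\to\mathbb{C}^2$ whose zero set $P^{-1}(0)$ does not meet $S^2$, the restrictions $P|_{S^2}:S^2\to\mathbb{C}^2\setminus\{0\}$ and $\rho_1(P)|_{S^2}:S^2\to\mathbb{CP}^1$ are null-homotopic. 5. The restriction $g|_{S^2}:S^2\to\mathbb{CP}^1$ is not null-homotopic. 6. $g$ cannot be uniformly approximated on $S^2$ by rational mappings: for every metric $\mathrm{Dist}$ on $\mathbb{CP}^1$ which induces the topology there is a constant $\beta>0$ such that, for every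 polynomial mapping $P:\mathbb{C}^3\to\mathbb{C}^2$ with $P^{-1}(0)\cap S^2=\emptyset$, there is a point $w\in S^2$ with $\mathrm{Dist}\bigl[\rho_1(P(w)),g(w)\bigr]>\beta$. -/

import Mathlib

noncomputable section

/-- Complex projective space `ℂℙ^m`: the complex lines through the origin of `ℂ^(m+1)`. -/
def CP (m : ℕ) : Type := Projectivization ℂ (Fin (m + 1) → ℂ)

namespace CP

/-- The natural projection `ρ_m : ℂ^(m+1) ∖ {0} → ℂℙ^m`, sending `z` to the line `[z]`. -/
def rho (m : ℕ) (v : {v : Fin (m + 1) → ℂ // v ≠ 0}) : CP m := Projectivization.mk' ℂ v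

/-- The standard (quotient) topology of `ℂℙ^m`. -/
instance instTopologicalSpace (m : ℕ) : TopologicalSpace (CP m) :=
  TopologicalSpace.coinduced (rho m) inferInstance

/-- The domain `{[v] : v i ≠ 0}` of the `i`-th affine chart of `ℂℙ^m`. -/
def chartDomain {m : ℕ} (i : Fin (m + 1)) : Set (CP m) :=
  {p | ∃ v : {v : Fin (m + 1) → ℂ // v ≠ 0}, rho m v = p ∧ v.1 i ≠ 0}

/-- The affine coordinates `[v] ↦ (v j / v i)_j` of the `i`-th chart of `ℂℙ^m`
(the `i`-th of them is constantly `1` on the chart domain). -/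
def affineCoord {m : ℕ} (i : Fin (m + 1)) (p : CP m) : Fin (m + 1) → ℂ :=
  Projectivization.lift (fun v : {v : Fin (m + 1) → ℂ // v ≠ 0} => fun j => v.1 j / v.1 i)
    (by
      intro a b t h
      have ht : t ≠ 0 := by
        rintro rfl
        exact a.2 (by rw [h, zero_smul])
      funext j
      simp only [h, Pi.smul_apply, smul_eq_mul]
      exact mul_div_mul_left _ _ ht) p

/-- The point `[w, z]` of `ℂℙ^1`, for `(w, z) ≠ (0, 0)`. -/
def point (w z : ℂ) (h : (![w, z] : Fin 2 → ℂ) ≠ 0) : CP 1 := rho 1 ⟨![w, z], h⟩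

/-- The point `[t, 1]` of `ℂℙ^1`. -/
def pointLeft (t : ℂ) : CP 1 := point t 1 (fun h => one_ne_zero (congrFun h 1))

/-- The point `[1, t]` of `ℂℙ^1`. -/
def pointRight (t : ℂ) : CP 1 := point 1 t (fun h => one_ne_zero (congrFun h 0))

end CP

/-- A map `f` is holomorphic on the open set `U ⊆ ℂⁿ`, with values in `ℂℙ^m`: it is continuous
there, and its expression in each affine chart is holomorphic. -/
def HolomorphicToCP {n m : ℕ} (f : (Fin n → ℂ) → CP m) (U : Set (Fin n → ℂ)) : Prop :=
  ContinuousOn f U ∧ ∀ i : Fin (m + 1),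
    DifferentiableOn ℂ (fun z => CP.affineCoord i (f z)) (U ∩ f ⁻¹' CP.chartDomain i)

/-- Rationally convex compact subsets of `ℂⁿ`. -/
def RationallyConvex {n : ℕ} (K : Set (Fin n → ℂ)) : Prop :=
  IsCompact K ∧ ∀ y, y ∉ K → ∃ p : MvPolynomial (Fin n) ℂ,
    MvPolynomial.eval y p = 0 ∧ ∀ z ∈ K, MvPolynomial.eval z p ≠ 0

/-- The polynomial mapping `ℂⁿ → ℂ^(m+1)` with components `P j`. -/
def polyMap {n m : ℕ} (P : Fin (m + 1) → MvPolynomial (Fin n) ℂ) (z : Fin n → ℂ) :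
    Fin (m + 1) → ℂ :=
  fun j => MvPolynomial.eval z (P j)

/-- The critical set `P⁻¹(0)` of the rational mapping `ρ_m(P)`. -/
def criticalSet {n m : ℕ} (P : Fin (m + 1) → MvPolynomial (Fin n) ℂ) : Set (Fin n → ℂ) :=
  {z | polyMap P z = 0}

/-- The polynomial mapping `P`, off its zero set, as a map into `ℂ^(m+1) ∖ {0}`. -/
def polyMapNonzero {n m : ℕ} (P : Fin (m + 1) → MvPolynomial (Fin n) ℂ)
    (z : {z : Fin n → ℂ // z ∉ criticalSet P}) : {v : Fin (m + 1) → ℂ // v ≠ 0} :=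
  ⟨polyMap P z.1, z.2⟩

/-- The rational mapping `ρ_m(P)`, defined off the critical set of `P`. -/
def ratMap {n m : ℕ} (P : Fin (m + 1) → MvPolynomial (Fin n) ℂ)
    (z : {z : Fin n → ℂ // z ∉ criticalSet P}) : CP m :=
  CP.rho m (polyMapNonzero P z)

/-- The real two-sphere `{a² + b² + c² = 1} ⊂ ℝ³`, as a subset of `ℂ³`. -/
def realSphere : Set (Fin 3 → ℂ) :=
  {w | ∃ a b c : ℝ, a ^ 2 + b ^ 2 + c ^ 2 = 1 ∧ w = ![(a : ℂ), (b : ℂ), (c : ℂ)]}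

/-- The quadratic form `x² + y² + z²` on `ℂ³`. -/
def quad (w : Fin 3 → ℂ) : ℂ := w 0 ^ 2 + w 1 ^ 2 + w 2 ^ 2

/-- The set of `(x, y, z) ∈ ℂ³` with `x² + y² + z² ≠ 0` and `-π < arg (x² + y² + z²) < π`. -/
def slitDomain : Set (Fin 3 → ℂ) := {w | quad w ∈ Complex.slitPlane}

/-- The principal branch of `√(x² + y² + z²)`, normalised by `√1 = 1`. -/
def sqrtQuad (w : Fin 3 → ℂ) : ℂ := Complex.sqrt (quad w)

open Classical in
/-- The extension of stereographic projection: `[(x + iy)/(√(x² + y² + z²) + z), 1]` where the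
denominator does not vanish, and `[1, (x - iy)/(√(x² + y² + z²) - z)]` elsewhere.
Only its values on `slitDomain` are meaningful. -/
def stereoExt (w : Fin 3 → ℂ) : CP 1 :=
  if sqrtQuad w + w 2 ≠ 0 then
    CP.pointLeft ((w 0 + Complex.I * w 1) / (sqrtQuad w + w 2))
  else
    CP.pointRight ((w 0 - Complex.I * w 1) / (sqrtQuad w - w 2))

end

open Topology Filter

noncomputable section

/-! ### The projective space and holomorphic maps into it -/

namespace CP

/-! The obstruction to approximation is that stereographic projection does not lift through `CP.rho
1` to `ℂ² ∖ {0}`, whereas every `ρ₁(P)` is given with the lift `P`. If a lift existed, its second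
component would be nonzero over the closed upper hemisphere and its first over the lower one. Both
would then have continuous logarithms there, although their ratio winds once around the equator
(`not_exists_lift_stereoExt`).

Lifts are transferred by orthogonal projection. If `f` is a lift of one map and the line `g x` is
never orthogonal to `f x`, projecting `f x` onto `g x` lifts `g` (`exists_lift_of_overlap_ne_zero`).
Moving along a homotopy in small steps, every null-homotopic map lifts, so `g` is not
null-homotopic. Since orthogonal pairs of lines form a compact set off the diagonal, every metric
keeps them a positive distance apart. A map close enough to `g` is therefore nowhere orthogonal to
it and cannot be a `ρ₁(P)`.

Both vanishing statements are general position: a `C¹` image of a lower-dimensional space has dense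
complement. For `P` this gives a vector `u` that is no real multiple of a value on the sphere, and
segments towards `u` avoid `0`. For `π₂(S³)` a loop is perturbed off the line of the base point and
then contracted along segments. The null-homotopy of `P` does not use `π₂(S³) = 0`. -/

theorem continuous_rho (m : ℕ) : Continuous (rho m) := continuous_coinduced_rng

theorem rho_surjective (m : ℕ) : Function.Surjective (rho m) := by
  intro p
  induction p using Projectivization.ind with
  | h v hv => exact ⟨⟨v, hv⟩, rfl⟩

theorem continuous_iff_comp_rho {m : ℕ} {Y : Type*} [TopologicalSpace Y] {f : CP m → Y} :
    Continuous f ↔ Continuous (f ∘ rho m) := continuous_coinduced_dom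

theorem rho_eq_rho_iff {m : ℕ} (u v : {v : Fin (m + 1) → ℂ // v ≠ 0}) :
    rho m u = rho m v ↔ ∃ a : ℂ, a • v.1 = u.1 :=
  Projectivization.mk_eq_mk_iff' ℂ u.1 v.1 u.2 v.2

theorem rho_one_eq_rho_iff (u v : {v : Fin 2 → ℂ // v ≠ 0}) :
    rho 1 u = rho 1 v ↔ u.1 0 * v.1 1 = u.1 1 * v.1 0 := by
  rw [rho_eq_rho_iff]
  constructor
  · rintro ⟨a, h⟩
    rw [← h]
    simp only [Pi.smul_apply, smul_eq_mul]
    ring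
  · intro h
    by_cases h0 : v.1 0 = 0
    · have h1 : v.1 1 ≠ 0 := fun h1 => v.2 (by ext i; fin_cases i <;> simp [h0, h1])
      refine ⟨u.1 1 / v.1 1, ?_⟩
      have hu : u.1 0 = 0 := by simpa [h0, h1] using h
      ext i
      fin_cases i
      · simp [h0, hu]
      · simp [h1]
    · refine ⟨u.1 0 / v.1 0, ?_⟩
      ext i
      fin_cases i
      · simp [h0]
      · simp only [Fin.mk_one, Pi.smul_apply, smul_eq_mul]
        field_simp
        linear_combination h

theorem rho_mem_chartDomain {m : ℕ} {i : Fin (m + 1)} {v : {v : Fin (m + 1) → ℂ // v ≠ 0}}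
    (h : rho m v ∈ chartDomain i) : v.1 i ≠ 0 := by
  obtain ⟨u, hu, hi⟩ := h
  obtain ⟨a, ha⟩ := (rho_eq_rho_iff _ _).1 hu
  intro h0
  exact hi (by rw [← ha]; simp [h0])

end CP

/-- A local holomorphic lift to homogeneous coordinates suffices, since affine coordinates are
quotients of its components. -/
theorem holomorphicToCP_of_local {n m : ℕ} {f : (Fin n → ℂ) → CP m} {U : Set (Fin n → ℂ)}
    (h : ∀ w ∈ U, ∃ V : (Fin n → ℂ) → {v : Fin (m + 1) → ℂ // v ≠ 0},
      DifferentiableAt ℂ (fun z => (V z).1) w ∧ f =ᶠ[𝓝 w] CP.rho m ∘ V) :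
    HolomorphicToCP f U := by
  constructor
  · intro w hw
    obtain ⟨V, hV, hf⟩ := h w hw
    refine ContinuousAt.continuousWithinAt (ContinuousAt.congr ?_ hf.symm)
    exact (CP.continuous_rho m).continuousAt.comp
      (tendsto_subtype_rng.2 hV.continuousAt)
  · intro i w hw
    obtain ⟨V, hV, hf⟩ := h w hw.1
    have hi : (V w).1 i ≠ 0 := CP.rho_mem_chartDomain (by
      have : f w ∈ CP.chartDomain i := hw.2
      rwa [hf.self_of_nhds] at this)
    have hd : DifferentiableAt ℂ (fun z => fun j => (V z).1 j / (V z).1 i) w := by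
      rw [differentiableAt_pi] at hV ⊢
      intro j
      have hj := hV j
      have hi' := hV i
      fun_prop (disch := exact hi)
    refine (hd.congr_of_eventuallyEq ?_).differentiableWithinAt
    filter_upwards [hf] with z hz
    rw [hz]
    rfl

/-! ### The holomorphic extension of stereographic projection -/

theorem sqrtQuad_sq (w : Fin 3 → ℂ) : sqrtQuad w ^ 2 = quad w := by
  rw [sqrtQuad, Complex.sqrt]
  have := Complex.cpow_nat_inv_pow (quad w) (n := 2) two_ne_zero
  simp at this ⊢

theorem sqrtQuad_ne_zero {w : Fin 3 → ℂ} (hw : w ∈ slitDomain) : sqrtQuad w ≠ 0 := by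
  intro h
  have := sqrtQuad_sq w
  rw [h] at this
  exact Complex.slitPlane_ne_zero hw (by simpa using this.symm)

/-- Both sides equal `x² + y²`. This identity is why the two formulas for `g` agree. -/
theorem sqrtQuad_factor (w : Fin 3 → ℂ) :
    (w 0 + Complex.I * w 1) * (w 0 - Complex.I * w 1) =
      (sqrtQuad w + w 2) * (sqrtQuad w - w 2) := by
  have h := sqrtQuad_sq w
  rw [quad] at h
  linear_combination -h - w 1 ^ 2 * Complex.I_sq

theorem sqrtQuad_add_or_sub_ne_zero {w : Fin 3 → ℂ} (hw : w ∈ slitDomain) :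
    sqrtQuad w + w 2 ≠ 0 ∨ sqrtQuad w - w 2 ≠ 0 := by
  by_contra! h
  exact sqrtQuad_ne_zero hw (by linear_combination (h.1 + h.2) / 2)

theorem stereoExt_eq_pointLeft {w : Fin 3 → ℂ} (h : sqrtQuad w + w 2 ≠ 0) :
    stereoExt w = CP.pointLeft ((w 0 + Complex.I * w 1) / (sqrtQuad w + w 2)) := if_pos h

theorem stereoExt_eq_pointRight {w : Fin 3 → ℂ} (h : sqrtQuad w - w 2 ≠ 0) :
    stereoExt w = CP.pointRight ((w 0 - Complex.I * w 1) / (sqrtQuad w - w 2)) := by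
  by_cases h' : sqrtQuad w + w 2 ≠ 0
  · rw [stereoExt_eq_pointLeft h', CP.pointLeft, CP.pointRight, CP.point, CP.point,
      CP.rho_one_eq_rho_iff]
    have := sqrtQuad_factor w
    simp only [Matrix.cons_val_zero, Matrix.cons_val_one, mul_one]
    field_simp
    linear_combination this
  · exact if_neg h'

theorem isOpen_slitDomain : IsOpen slitDomain := by
  refine Complex.isOpen_slitPlane.preimage ?_
  unfold quad
  fun_prop

theorem differentiableAt_sqrtQuad {w : Fin 3 → ℂ} (hw : w ∈ slitDomain) :
    DifferentiableAt ℂ sqrtQuad w := by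
  refine DifferentiableAt.comp w (Complex.differentiableAt_sqrt hw) ?_
  unfold quad
  fun_prop

theorem holomorphicToCP_stereoExt : HolomorphicToCP stereoExt slitDomain := by
  refine holomorphicToCP_of_local fun w hw => ?_
  have hs := differentiableAt_sqrtQuad hw
  rcases sqrtQuad_add_or_sub_ne_zero hw with h | h
  · refine ⟨fun z => ⟨![(z 0 + Complex.I * z 1) / (sqrtQuad z + z 2), 1],
      fun h => one_ne_zero (congrFun h 1)⟩, ?_, ?_⟩
    · rw [differentiableAt_pi]
      intro i
      fin_cases i
      · change DifferentiableAt ℂ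
          (fun z : Fin 3 → ℂ => (z 0 + Complex.I * z 1) / (sqrtQuad z + z 2)) w
        fun_prop (disch := exact h)
      · exact differentiableAt_const _
    · have hc : ContinuousAt (fun z => sqrtQuad z + z 2) w :=
        hs.continuousAt.add (continuous_apply 2).continuousAt
      filter_upwards [hc.eventually_ne h] with z hz using stereoExt_eq_pointLeft hz
  · refine ⟨fun z => ⟨![1, (z 0 - Complex.I * z 1) / (sqrtQuad z - z 2)],
      fun h => one_ne_zero (congrFun h 0)⟩, ?_, ?_⟩
    · rw [differentiableAt_pi]
      intro i
      fin_cases i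
      · exact differentiableAt_const _
      · change DifferentiableAt ℂ
          (fun z : Fin 3 → ℂ => (z 0 - Complex.I * z 1) / (sqrtQuad z - z 2)) w
        fun_prop (disch := exact h)
    · have hc : ContinuousAt (fun z => sqrtQuad z - z 2) w :=
        hs.continuousAt.sub (continuous_apply 2).continuousAt
      filter_upwards [hc.eventually_ne h] with z hz using stereoExt_eq_pointRight hz

/-! ### Restriction to the sphere; rational convexity -/

theorem quad_of_mem_realSphere {w : Fin 3 → ℂ} (hw : w ∈ realSphere) : quad w = 1 := by
  obtain ⟨a, b, c, h, rfl⟩ := hw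
  simp only [quad, Matrix.cons_val_zero, Matrix.cons_val_one, Matrix.cons_val]
  exact_mod_cast h

theorem sqrtQuad_of_mem_realSphere {w : Fin 3 → ℂ} (hw : w ∈ realSphere) : sqrtQuad w = 1 := by
  rw [sqrtQuad, quad_of_mem_realSphere hw, Complex.sqrt_one]

theorem realSphere_subset_slitDomain : realSphere ⊆ slitDomain := fun w hw => by
  rw [slitDomain, Set.mem_ofPred_eq, quad_of_mem_realSphere hw]
  exact Complex.one_mem_slitPlane

theorem stereoExt_sphere_left {a b c : ℝ} (h : a ^ 2 + b ^ 2 + c ^ 2 = 1) (hc : c ≠ -1) :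
    stereoExt ![(a : ℂ), (b : ℂ), (c : ℂ)] =
      CP.pointLeft (((a : ℂ) + Complex.I * b) / (1 + c)) := by
  have hs := sqrtQuad_of_mem_realSphere ⟨a, b, c, h, rfl⟩
  rw [stereoExt_eq_pointLeft, hs]
  · rfl
  · rw [hs]
    intro h0
    have h0 : (1 : ℂ) + c = 0 := h0
    exact hc (by have : 1 + c = 0 := by exact_mod_cast h0
                 linarith)

theorem stereoExt_sphere_right {a b c : ℝ} (h : a ^ 2 + b ^ 2 + c ^ 2 = 1) (hc : c ≠ 1) :
    stereoExt ![(a : ℂ), (b : ℂ), (c : ℂ)] =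
      CP.pointRight (((a : ℂ) - Complex.I * b) / (1 - c)) := by
  have hs := sqrtQuad_of_mem_realSphere ⟨a, b, c, h, rfl⟩
  rw [stereoExt_eq_pointRight, hs]
  · rfl
  · rw [hs]
    intro h0
    have h0 : (1 : ℂ) - c = 0 := h0
    exact hc (by have : 1 - c = 0 := by exact_mod_cast h0
                 linarith)

theorem continuous_stereoExt_sphere : Continuous fun w : realSphere => stereoExt w.1 :=
  (holomorphicToCP_stereoExt.1.mono realSphere_subset_slitDomain).domRestrict

theorem isCompact_realSphere : IsCompact realSphere := by
  have h : realSphere = (fun v : EuclideanSpace ℝ (Fin 3) => ![(v 0 : ℂ), (v 1 : ℂ), (v 2 : ℂ)]) ''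
      Metric.sphere 0 1 := by
    ext w
    constructor
    · rintro ⟨a, b, c, h, rfl⟩
      refine ⟨!₂[a, b, c], ?_, rfl⟩
      rw [mem_sphere_zero_iff_norm, EuclideanSpace.norm_eq, Real.sqrt_eq_one]
      simpa [Fin.sum_univ_three] using h
    · rintro ⟨v, hv, rfl⟩
      refine ⟨v 0, v 1, v 2, ?_, rfl⟩
      rw [mem_sphere_zero_iff_norm, EuclideanSpace.norm_eq, Real.sqrt_eq_one] at hv
      simpa [Fin.sum_univ_three] using hv
  rw [h]
  refine (isCompact_sphere _ _).image ?_
  refine continuous_pi fun i => ?_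
  fin_cases i <;> simp <;> fun_prop

instance : CompactSpace realSphere := isCompact_iff_compactSpace.1 isCompact_realSphere

theorem rationallyConvex_realSphere : RationallyConvex realSphere := by
  refine ⟨isCompact_realSphere, fun y hy => ?_⟩
  by_cases hq : quad y = 1
  -- Separate `y` by the linear form `⟨z, y⟩ - ⟨y, y⟩`. Write `y = R + iT`, so that `|R|² - |T|² =
  -- 1`. A zero at a real unit vector `a` gives `a·R = |R|² + |T|²`, and then `|a - R|² ≥ 0` forces
  -- `T = 0`, so `y` lies on the sphere.
  · obtain ⟨q, hq'⟩ : ∃ q : MvPolynomial (Fin 3) ℂ, ∀ z, MvPolynomial.eval z q =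
        z 0 * star (y 0) + z 1 * star (y 1) + z 2 * star (y 2) :=
      ⟨.X 0 * .C (star (y 0)) + .X 1 * .C (star (y 1)) + .X 2 * .C (star (y 2)), fun z => by simp⟩
    refine ⟨q - .C (MvPolynomial.eval y q), by simp, ?_⟩
    rintro z ⟨a, b, c, h, rfl⟩ h0
    simp only [map_sub, MvPolynomial.eval_C, hq', Matrix.cons_val_zero, Matrix.cons_val_one,
      Matrix.cons_val] at h0
    have hre := congrArg Complex.re h0
    simp at hre
    have hqre := congrArg Complex.re hq
    simp [quad, pow_two] at hqre
    have him : (y 0).im = 0 ∧ (y 1).im = 0 ∧ (y 2).im = 0 := by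
      have key : (y 0).im ^ 2 + (y 1).im ^ 2 + (y 2).im ^ 2 ≤ 0 := by
        nlinarith [sq_nonneg (a - (y 0).re), sq_nonneg (b - (y 1).re), sq_nonneg (c - (y 2).re)]
      refine ⟨?_, ?_, ?_⟩ <;>
        nlinarith [sq_nonneg (y 0).im, sq_nonneg (y 1).im, sq_nonneg (y 2).im]
    apply hy
    refine ⟨(y 0).re, (y 1).re, (y 2).re, ?_, ?_⟩
    · simp only [him.1, him.2.1, him.2.2] at hqre
      linarith
    · ext i
      fin_cases i <;> apply Complex.ext <;> simp [him]
  · refine ⟨.X 0 ^ 2 + .X 1 ^ 2 + .X 2 ^ 2 - .C (quad y), by simp [quad], fun z hz h0 => hq ?_⟩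
    have := quad_of_mem_realSphere hz
    simp only [map_sub, map_add, map_pow, MvPolynomial.eval_X, MvPolynomial.eval_C] at h0
    rw [quad] at this
    linear_combination this - h0

/-! ### The inverse of stereographic projection -/

/-- The inverse of stereographic projection, in homogeneous coordinates. -/
def hopfVec (v : Fin 2 → ℂ) : Fin 3 → ℂ :=
  ![((2 * (v 0 * star (v 1)).re / (Complex.normSq (v 0) + Complex.normSq (v 1)) : ℝ) : ℂ),
    ((2 * (v 0 * star (v 1)).im / (Complex.normSq (v 0) + Complex.normSq (v 1)) : ℝ) : ℂ),
    (((Complex.normSq (v 1) - Complex.normSq (v 0)) /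
      (Complex.normSq (v 0) + Complex.normSq (v 1)) : ℝ) : ℂ)]

theorem normSq_add_normSq_pos {v : Fin 2 → ℂ} (hv : v ≠ 0) :
    0 < Complex.normSq (v 0) + Complex.normSq (v 1) := by
  have h0 := Complex.normSq_nonneg (v 0)
  have h1 := Complex.normSq_nonneg (v 1)
  rcases h0.lt_or_eq with h | h
  · linarith
  rcases h1.lt_or_eq with h' | h'
  · linarith
  refine absurd ?_ hv
  ext i
  fin_cases i
  · exact Complex.normSq_eq_zero.1 h.symm
  · exact Complex.normSq_eq_zero.1 h'.symm

theorem hopfVec_mem {v : Fin 2 → ℂ} (hv : v ≠ 0) : hopfVec v ∈ realSphere := by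
  refine ⟨_, _, _, ?_, rfl⟩
  have h := (normSq_add_normSq_pos hv).ne'
  field_simp
  simp only [Complex.normSq_apply, Complex.mul_re, Complex.mul_im, Complex.star_def,
    Complex.conj_re, Complex.conj_im]
  ring

theorem hopfVec_smul {a : ℂ} (ha : a ≠ 0) (v : Fin 2 → ℂ) : hopfVec (a • v) = hopfVec v := by
  have h := (Complex.normSq_pos.2 ha).ne'
  have h1 : a • v 0 * star (a • v 1) = (Complex.normSq a : ℝ) * (v 0 * star (v 1)) := by
    simp only [smul_eq_mul, star_mul', Complex.normSq_eq_conj_mul_self, Complex.star_def]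
    ring
  unfold hopfVec
  simp only [Pi.smul_apply, h1, Complex.re_ofReal_mul, Complex.im_ofReal_mul]
  simp only [smul_eq_mul, Complex.normSq_mul, ← mul_add, ← mul_sub, mul_left_comm (2 : ℝ),
    mul_div_mul_left _ _ h]

/-- The inverse of stereographic projection. -/
def stereoInv (p : CP 1) : realSphere :=
  Projectivization.lift
    (fun v : {v : Fin 2 → ℂ // v ≠ 0} => (⟨hopfVec v.1, hopfVec_mem v.2⟩ : realSphere))
    (by
      intro a b t h
      have ht : t ≠ 0 := by
        rintro rfl
        exact a.2 (by rw [h, zero_smul])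
      exact Subtype.ext (by simp only [h]; exact hopfVec_smul ht _)) p

theorem continuous_stereoInv : Continuous stereoInv := by
  rw [CP.continuous_iff_comp_rho]
  refine Continuous.subtype_mk (f := fun v : {v : Fin 2 → ℂ // v ≠ 0} => hopfVec v.1) ?_ _
  have h (v : {v : Fin 2 → ℂ // v ≠ 0}) := (normSq_add_normSq_pos v.2).ne'
  have h0 : Continuous fun v : {v : Fin 2 → ℂ // v ≠ 0} => v.1 0 :=
    (continuous_apply 0).comp continuous_subtype_val
  have h1 : Continuous fun v : {v : Fin 2 → ℂ // v ≠ 0} => v.1 1 :=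
    (continuous_apply 1).comp continuous_subtype_val
  have n0 := Complex.continuous_normSq.comp h0
  have n1 := Complex.continuous_normSq.comp h1
  have m := h0.mul h1.star
  refine continuous_pi fun i => ?_
  fin_cases i
  · exact Complex.continuous_ofReal.comp
      (((Complex.continuous_re.comp m).const_mul 2).div₀ (n0.add n1) h)
  · exact Complex.continuous_ofReal.comp
      (((Complex.continuous_im.comp m).const_mul 2).div₀ (n0.add n1) h)
  · exact Complex.continuous_ofReal.comp ((n1.sub n0).div₀ (n0.add n1) h)

theorem stereoInv_stereoExt (w : realSphere) : stereoInv (stereoExt w.1) = w := by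
  obtain ⟨w, a, b, c, h, rfl⟩ := w
  apply Subtype.ext
  by_cases hc : c = -1
  · subst hc
    have hab : a = 0 ∧ b = 0 := ⟨by nlinarith, by nlinarith⟩
    rw [stereoExt_sphere_right h (by norm_num)]
    change hopfVec ![1, _] = _
    ext i
    fin_cases i <;> simp [hopfVec, hab]
  · rw [stereoExt_sphere_left h hc]
    change hopfVec ![_, 1] = _
    have hc' : 1 + c ≠ 0 := fun h' => hc (by linarith)
    have e : ((a : ℂ) + Complex.I * b) / (1 + c) = ⟨a / (1 + c), b / (1 + c)⟩ := by
      have : (1 + c : ℂ) ≠ 0 := by exact_mod_cast hc'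
      rw [Complex.mk_eq_add_mul_I]
      push_cast
      field_simp
    -- On the sphere `a² + b² = (1 - c)(1 + c)`.
    have hn : Complex.normSq ⟨a / (1 + c), b / (1 + c)⟩ = (1 - c) / (1 + c) := by
      rw [Complex.normSq_mk]
      field_simp
      linear_combination h
    have hN : (1 - c) / (1 + c) + 1 = 2 / (1 + c) := by
      field_simp
      ring
    have hM : 1 - (1 - c) / (1 + c) = 2 * c / (1 + c) := by
      field_simp
      ring
    ext i
    fin_cases i
    · simp only [hopfVec, Matrix.cons_val_zero, Matrix.cons_val_one, star_one, mul_one,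
        hn, Complex.normSq_one, hN, e, Fin.zero_eta]
      congr 1
      field_simp
    · simp only [hopfVec, Matrix.cons_val_zero, Matrix.cons_val_one, star_one, mul_one,
        hn, Complex.normSq_one, hN, e, Fin.mk_one]
      congr 1
      field_simp
    · simp only [hopfVec, Matrix.cons_val_zero, Matrix.cons_val_one, star_one, mul_one,
        hn, Complex.normSq_one, hN, hM, e, Fin.reduceFinMk, Matrix.cons_val]
      congr 1
      field_simp

/-- With `N = |v₀|² + |v₁|²`, the point `hopfVec v` has `x + iy = 2 v₀ v̄₁ / N`, `1 + z = 2|v₁|² /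
N` and `1 - z = 2|v₀|² / N`, so the quotients reduce to `v₀ / v₁` and `v₁ / v₀`. -/
theorem stereoExt_hopfVec (v : {v : Fin 2 → ℂ // v ≠ 0}) :
    stereoExt (hopfVec v.1) = CP.rho 1 v := by
  have hN := (normSq_add_normSq_pos v.2).ne'
  obtain ⟨v, hv⟩ := v
  dsimp only at hN ⊢
  have hs := sqrtQuad_of_mem_realSphere (hopfVec_mem hv)
  set N := Complex.normSq (v 0) + Complex.normSq (v 1) with hNdef
  have hN' : (N : ℂ) ≠ 0 := by exact_mod_cast hN
  have n0 : (Complex.normSq (v 0) : ℂ) = v 0 * star (v 0) := (Complex.mul_conj _).symm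
  have n1 : (Complex.normSq (v 1) : ℂ) = v 1 * star (v 1) := (Complex.mul_conj _).symm
  have hNc : (N : ℂ) = v 0 * star (v 0) + v 1 * star (v 1) := by
    rw [hNdef]; push_cast; rw [n0, n1]
  have x : hopfVec v 0 + Complex.I * hopfVec v 1 = 2 * (v 0 * star (v 1)) / N := by
    rw [← Complex.re_add_im (v 0 * star (v 1))]
    simp only [hopfVec, Matrix.cons_val_zero, Matrix.cons_val_one, ← hNdef]
    push_cast
    ring
  have y : hopfVec v 0 - Complex.I * hopfVec v 1 = 2 * (star (v 0) * v 1) / N := by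
    have : star (v 0) * v 1 = star (v 0 * star (v 1)) := by simp
    have hc (u : ℂ) : star u = u.re - u.im * Complex.I := by
      apply Complex.ext <;> simp
    rw [this, hc]
    simp only [hopfVec, Matrix.cons_val_zero, Matrix.cons_val_one, ← hNdef]
    push_cast
    ring
  have z : hopfVec v 2 = (v 1 * star (v 1) - v 0 * star (v 0)) / N := by
    simp only [hopfVec, Matrix.cons_val, ← hNdef]
    push_cast
    rw [n0, n1]
  have zp : sqrtQuad (hopfVec v) + hopfVec v 2 = 2 * (v 1 * star (v 1)) / N := by
    rw [hs, z]
    field_simp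
    rw [hNc]
    ring
  have zm : sqrtQuad (hopfVec v) - hopfVec v 2 = 2 * (v 0 * star (v 0)) / N := by
    rw [hs, z]
    field_simp
    rw [hNc]
    ring
  by_cases h1 : v 1 = 0
  · have h0 : v 0 ≠ 0 := fun h0 => hv (by ext i; fin_cases i <;> simp [h0, h1])
    have h0' : star (v 0) ≠ 0 := star_ne_zero.2 h0
    rw [stereoExt_eq_pointRight (by
      rw [zm]
      exact div_ne_zero (mul_ne_zero two_ne_zero (mul_ne_zero h0 h0')) hN'), CP.pointRight, CP.point,
      CP.rho_one_eq_rho_iff, y, h1]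
    simp [h1]
  · have h1' : star (v 1) ≠ 0 := star_ne_zero.2 h1
    rw [stereoExt_eq_pointLeft (by
      rw [zp]
      exact div_ne_zero (mul_ne_zero two_ne_zero (mul_ne_zero h1 h1')) hN'), CP.pointLeft, CP.point,
      CP.rho_one_eq_rho_iff, x, zp]
    simp only [Matrix.cons_val_zero, Matrix.cons_val_one]
    field_simp

theorem stereoExt_stereoInv (p : CP 1) : stereoExt (stereoInv p).1 = p := by
  obtain ⟨v, rfl⟩ := CP.rho_surjective 1 p
  exact stereoExt_hopfVec v

theorem isHomeomorph_stereoExt : IsHomeomorph fun w : realSphere => stereoExt w.1 :=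
  isHomeomorph_iff_exists_inverse.2 ⟨continuous_stereoExt_sphere, stereoInv,
    stereoInv_stereoExt, stereoExt_stereoInv, continuous_stereoInv⟩

instance : CompactSpace (CP 1) :=
  isHomeomorph_stereoExt.surjective.compactSpace continuous_stereoExt_sphere

/-! ### Stereographic projection has no lift -/

/-- The point `d / max 1 |d|` of the closed unit disc. -/
def discRetract (d : ℂ) : ℂ := d / (max 1 ‖d‖ : ℝ)

theorem continuous_discRetract : Continuous discRetract := by
  refine continuous_id.div₀ (by fun_prop) fun d => ?_
  have : 0 < max 1 ‖d‖ := lt_max_of_lt_left one_pos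
  exact_mod_cast this.ne'

theorem normSq_discRetract_le (d : ℂ) : Complex.normSq (discRetract d) ≤ 1 := by
  have h : 0 < max 1 ‖d‖ := lt_max_of_lt_left one_pos
  have : ‖discRetract d‖ ≤ 1 := by
    rw [discRetract, norm_div, Complex.norm_real, Real.norm_of_nonneg h.le, div_le_one h]
    exact le_max_right _ _
  rw [Complex.normSq_eq_norm_sq]
  exact pow_le_one₀ (norm_nonneg _) this

theorem discRetract_of_norm_eq_one {d : ℂ} (h : ‖d‖ = 1) : discRetract d = d := by
  simp [discRetract, h]

/-- The point of the sphere over a point of the disc, on the upper or lower hemisphere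
according to the sign `σ`. -/
def hemisphere (σ : ℤˣ) (d : ℂ) : realSphere :=
  ⟨![((discRetract d).re : ℂ), ((discRetract d).im : ℂ),
    (((σ : ℤ) * √(1 - Complex.normSq (discRetract d)) : ℝ) : ℂ)], _, _, _, by
      have h := normSq_discRetract_le d
      have hσ : ((σ : ℤ) : ℝ) ^ 2 = 1 := by
        rcases Int.units_eq_one_or σ with rfl | rfl <;> simp
      rw [mul_pow, Real.sq_sqrt (by linarith), hσ, Complex.normSq_apply]
      ring, rfl⟩

theorem continuous_hemisphere (σ : ℤˣ) : Continuous (hemisphere σ) := by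
  have h := continuous_discRetract
  have hn := Complex.continuous_normSq.comp h
  refine Continuous.subtype_mk (continuous_pi fun i => ?_) _
  fin_cases i
  · exact Complex.continuous_ofReal.comp (Complex.continuous_re.comp h)
  · exact Complex.continuous_ofReal.comp (Complex.continuous_im.comp h)
  · exact Complex.continuous_ofReal.comp
      (((continuous_const.sub hn).sqrt).const_mul _)

theorem hemisphere_of_norm_eq_one {d : ℂ} (h : ‖d‖ = 1) (σ : ℤˣ) :
    (hemisphere σ d).1 = ![(d.re : ℂ), (d.im : ℂ), ((0 : ℝ) : ℂ)] := by
  simp [hemisphere, discRetract_of_norm_eq_one h, Complex.normSq_eq_norm_sq, h]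

/-- `exp` is a covering of `ℂ ∖ {0}` and the plane is simply connected. This is why the hemispheres
are parametrized by all of `ℂ`. -/
theorem exists_continuous_exp_eq {g : ℂ → ℂ} (hg : Continuous g) (h0 : ∀ z, g z ≠ 0) :
    ∃ f : ℂ → ℂ, Continuous f ∧ ∀ z, Complex.exp (f z) = g z := by
  obtain ⟨F, ⟨-, hF⟩, -⟩ := Complex.isCoveringMapOn_exp.existsUnique_continuousMap_lifts
    (A := ℂ) ⟨g, hg⟩ (Complex.exp_log (h0 0)) h0
  exact ⟨F, F.continuous, fun z => congrFun hF z⟩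

/-- A continuous function on the line with values in `2πiℤ` is constant. -/
theorem eq_of_forall_exp_eq_one {D : ℝ → ℂ} (hD : Continuous D) (h1 : ∀ t, Complex.exp (D t) = 1)
    {a b : ℝ} : D a = D b := by
  choose n hn using fun t => Complex.exp_eq_one_iff.1 (h1 t)
  have hpi : (2 * Real.pi * Complex.I : ℂ) ≠ 0 := Complex.two_pi_I_ne_zero
  have hc : Continuous fun t => (n t : ℝ) := by
    have : (fun t => (n t : ℝ)) = fun t => (D t / (2 * Real.pi * Complex.I)).re := by
      funext t
      rw [hn t, mul_div_cancel_right₀ _ hpi, Complex.intCast_re]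
    rw [this]
    exact Complex.continuous_re.comp (hD.div_const _)
  have hc' : Continuous n := Int.isClosedEmbedding_coe_real.isEmbedding.continuous_iff.2 hc
  have hconst : n a = n b := PreconnectedSpace.constant inferInstance hc'
  rw [hn a, hn b, hconst]

/-- Stereographic projection does not lift to `ℂ² ∖ {0}`. -/
theorem not_exists_lift_stereoExt :
    ¬ ∃ f : realSphere → {v : Fin 2 → ℂ // v ≠ 0}, Continuous f ∧
      ∀ w, CP.rho 1 (f w) = stereoExt w.1 := by
  rintro ⟨f, hf, hfg⟩
  have hc (i : Fin 2) (σ : ℤˣ) : Continuous fun d => (f (hemisphere σ d)).1 i :=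
    (continuous_apply i).comp
      (continuous_subtype_val.comp (hf.comp (continuous_hemisphere σ)))
  have hne (v : {v : Fin 2 → ℂ // v ≠ 0}) (h0 : v.1 0 = 0) (h1 : v.1 1 = 0) : False :=
    v.2 (by ext i; fin_cases i <;> simp [h0, h1])
  have hq {w : realSphere} {a b c : ℝ} (hw : w.1 = ![(a : ℂ), (b : ℂ), (c : ℂ)]) :
      a ^ 2 + b ^ 2 + c ^ 2 = 1 := by
    have := quad_of_mem_realSphere w.2
    rw [hw] at this
    simp only [quad, Matrix.cons_val_zero, Matrix.cons_val_one, Matrix.cons_val] at this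
    exact_mod_cast this
  have left {w : realSphere} {a b c : ℝ} (hw : w.1 = ![(a : ℂ), (b : ℂ), (c : ℂ)])
      (hc : c ≠ -1) : (f w).1 0 = (f w).1 1 * (((a : ℂ) + Complex.I * b) / (1 + c)) := by
    have := hfg w
    rw [hw, stereoExt_sphere_left (hq hw) hc, CP.pointLeft, CP.point,
      CP.rho_one_eq_rho_iff] at this
    simpa using this
  have right {w : realSphere} {a b c : ℝ} (hw : w.1 = ![(a : ℂ), (b : ℂ), (c : ℂ)])
      (hc : c ≠ 1) : (f w).1 1 = (f w).1 0 * (((a : ℂ) - Complex.I * b) / (1 - c)) := by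
    have := hfg w
    rw [hw, stereoExt_sphere_right (hq hw) hc, CP.pointRight, CP.point,
      CP.rho_one_eq_rho_iff] at this
    simpa using this.symm
  -- Over the upper hemisphere `c ≥ 0`, the first component is a multiple of the second, so the
  -- second never vanishes. The roles are exchanged below.
  obtain ⟨A, hA, hA'⟩ := exists_continuous_exp_eq (hc 1 1) (fun d h => by
    refine hne _ ?_ h
    rw [left (w := hemisphere 1 d) rfl, h, zero_mul]
    have := Real.sqrt_nonneg (1 - Complex.normSq (discRetract d))
    intro h'
    simp only [Units.val_one, Int.cast_one, one_mul] at h'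
    linarith)
  obtain ⟨B, hB, hB'⟩ := exists_continuous_exp_eq (hc 0 (-1)) (fun d h => by
    refine hne _ h ?_
    rw [right (w := hemisphere (-1) d) rfl, h, zero_mul]
    have := Real.sqrt_nonneg (1 - Complex.normSq (discRetract d))
    intro h'
    simp only [Units.val_neg, Units.val_one, Int.cast_neg, Int.cast_one, neg_one_mul] at h'
    linarith)
  have hnorm (t : ℝ) : ‖Complex.exp (t * Complex.I)‖ = 1 := Complex.norm_exp_ofReal_mul_I t
  -- On the equator the hemispheres meet and `f₀ = d f₁` with `d = exp(it)`, so `B - A - it` takes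
  -- values in `2πiℤ`.
  have hD := eq_of_forall_exp_eq_one
    (D := fun t : ℝ => B (Complex.exp (t * Complex.I)) - A (Complex.exp (t * Complex.I)) -
      t * Complex.I) (by fun_prop) (fun t => by
        set d := Complex.exp (t * Complex.I) with hd
        have e (σ : ℤˣ) := hemisphere_of_norm_eq_one (hnorm t) σ
        rw [← hd] at e
        have he : hemisphere (-1) d = hemisphere 1 d := Subtype.ext ((e _).trans (e _).symm)
        have hl := left (e 1) (by norm_num)
        have hre : (d.re : ℂ) + Complex.I * d.im = d := by
          rw [mul_comm]; exact Complex.re_add_im d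
        rw [Complex.ofReal_zero, add_zero, div_one, hre] at hl
        rw [Complex.exp_sub, Complex.exp_sub, hA', hB', he, ← hd, hl]
        have hd0 : d ≠ 0 := Complex.exp_ne_zero _
        have h1 : (f (hemisphere 1 d)).1 1 ≠ 0 := fun h => hne _ (by rw [hl, h, zero_mul]) h
        field_simp) (a := 0) (b := 2 * Real.pi)
  -- `t = 0` and `t = 2π` give the same `d`, so `A` and `B` cancel and only `2πi = 0` remains.
  simp [Complex.exp_two_pi_mul_I] at hD
  have : (2 * Real.pi * Complex.I : ℂ) = 0 := by linear_combination hD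
  exact Complex.two_pi_I_ne_zero this

/-! ### Transferring lifts by orthogonal projection -/

/-- The matrix of the orthogonal projection of `ℂ²` onto the line of a nonzero vector. -/
def lineProj (p : CP 1) : Fin 2 → Fin 2 → ℂ :=
  Projectivization.lift
    (fun v : {v : Fin 2 → ℂ // v ≠ 0} => fun i j =>
      v.1 i * star (v.1 j) / ((Complex.normSq (v.1 0) + Complex.normSq (v.1 1) : ℝ) : ℂ))
    (by
      intro a b t h
      have ht : t ≠ 0 := by
        rintro rfl
        exact a.2 (by rw [h, zero_smul])
      have ht' : (Complex.normSq t : ℂ) ≠ 0 := by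
        exact_mod_cast (Complex.normSq_pos.2 ht).ne'
      funext i j
      simp only [h, Pi.smul_apply, smul_eq_mul, Complex.normSq_mul, star_mul', ← mul_add,
        Complex.ofReal_mul]
      rw [mul_mul_mul_comm, Complex.star_def, Complex.mul_conj, mul_div_mul_left _ _ ht']) p

theorem continuous_lineProj : Continuous lineProj := by
  rw [CP.continuous_iff_comp_rho]
  have hv (i : Fin 2) : Continuous fun v : {v : Fin 2 → ℂ // v ≠ 0} => v.1 i :=
    (continuous_apply i).comp continuous_subtype_val
  refine continuous_pi fun i => continuous_pi fun j => ?_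
  refine Continuous.div₀ ((hv i).mul (hv j).star) (Complex.continuous_ofReal.comp
    ((Complex.continuous_normSq.comp (hv 0)).add (Complex.continuous_normSq.comp (hv 1))))
    fun v => ?_
  exact_mod_cast (normSq_add_normSq_pos v.2).ne'

/-- The trace of the product of the projections onto two lines of `ℂ²`: it vanishes if and only if
the lines are orthogonal. -/
def overlap (p q : CP 1) : ℂ := ∑ i, ∑ j, lineProj p i j * lineProj q j i

theorem continuous_overlap : Continuous fun x : CP 1 × CP 1 => overlap x.1 x.2 := by
  unfold overlap
  have h (i j : Fin 2) : Continuous fun p => lineProj p i j :=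
    (continuous_apply j).comp ((continuous_apply i).comp continuous_lineProj)
  exact continuous_finsetSum _ fun i _ => continuous_finsetSum _ fun j _ =>
    ((h i j).comp continuous_fst).mul ((h j i).comp continuous_snd)

/-- The right side is `|⟨u, v⟩|² / (|u|² |v|²)`, the squared cosine of the angle between the lines.
-/
theorem overlap_rho (u v : {v : Fin 2 → ℂ // v ≠ 0}) :
    overlap (CP.rho 1 u) (CP.rho 1 v) =
      (star (u.1 0) * v.1 0 + star (u.1 1) * v.1 1) *
        (u.1 0 * star (v.1 0) + u.1 1 * star (v.1 1)) /
        (((Complex.normSq (u.1 0) + Complex.normSq (u.1 1) : ℝ) : ℂ) *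
          ((Complex.normSq (v.1 0) + Complex.normSq (v.1 1) : ℝ) : ℂ)) := by
  simp only [overlap, Fin.sum_univ_two]
  change u.1 0 * _ / _ * (v.1 0 * _ / _) + u.1 0 * _ / _ * (v.1 1 * _ / _) +
    (u.1 1 * _ / _ * (v.1 0 * _ / _) + u.1 1 * _ / _ * (v.1 1 * _ / _)) = _
  simp only [div_mul_div_comm, ← add_div]
  congr 1
  ring

theorem overlap_self (p : CP 1) : overlap p p = 1 := by
  obtain ⟨v, rfl⟩ := CP.rho_surjective 1 p
  have h : ((Complex.normSq (v.1 0) + Complex.normSq (v.1 1) : ℝ) : ℂ) ≠ 0 := by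
    exact_mod_cast (normSq_add_normSq_pos v.2).ne'
  rw [overlap_rho, div_eq_one_iff_eq (mul_ne_zero h h)]
  simp only [Complex.ofReal_add, Complex.normSq_eq_conj_mul_self, Complex.star_def]
  ring

/-- A map to `ℂℙ¹` lifts to `ℂ² ∖ {0}` if it is nowhere orthogonal to a map that lifts. -/
theorem exists_lift_of_overlap_ne_zero {X : Type*} [TopologicalSpace X] {g : X → CP 1}
    (hg : Continuous g) {f : X → {v : Fin 2 → ℂ // v ≠ 0}} (hf : Continuous f)
    (h : ∀ x, overlap (g x) (CP.rho 1 (f x)) ≠ 0) :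
    ∃ F : X → {v : Fin 2 → ℂ // v ≠ 0}, Continuous F ∧ ∀ x, CP.rho 1 (F x) = g x := by
  have key (x : X) : ∃ hx : (fun i => ∑ j, lineProj (g x) i j * (f x).1 j) ≠ 0,
      CP.rho 1 ⟨_, hx⟩ = g x := by
    obtain ⟨u, hu⟩ := CP.rho_surjective 1 (g x)
    have hx := h x
    rw [← hu] at hx ⊢
    set v := f x
    rw [overlap_rho] at hx
    have hN : ((Complex.normSq (u.1 0) + Complex.normSq (u.1 1) : ℝ) : ℂ) ≠ 0 := by
      exact_mod_cast (normSq_add_normSq_pos u.2).ne'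
    -- The projection of `v` to the line of `u` is `(⟨u, v⟩ / |u|²) u`, and `⟨u, v⟩` is a factor of
    -- the nonzero overlap.
    have e : (fun i => ∑ j, lineProj (CP.rho 1 u) i j * v.1 j) =
        ((star (u.1 0) * v.1 0 + star (u.1 1) * v.1 1) /
          ((Complex.normSq (u.1 0) + Complex.normSq (u.1 1) : ℝ) : ℂ)) • u.1 := by
      funext i
      rw [Fin.sum_univ_two]
      change u.1 i * _ / _ * _ + u.1 i * _ / _ * _ = _ * u.1 i
      field_simp
    have hx' := div_ne_zero
      (left_ne_zero_of_mul (left_ne_zero_of_mul ((div_eq_mul_inv (G := ℂ) _ _) ▸ hx))) hN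
    refine ⟨e ▸ smul_ne_zero hx' u.2, ?_⟩
    rw [CP.rho_eq_rho_iff]
    exact ⟨_, e.symm⟩
  choose hx hg' using key
  refine ⟨fun x => ⟨_, hx x⟩, Continuous.subtype_mk (continuous_pi fun i => ?_) _, hg'⟩
  refine continuous_finsetSum _ fun j _ => Continuous.mul ?_ ?_
  · exact (continuous_apply j).comp ((continuous_apply i).comp (continuous_lineProj.comp hg))
  · exact (continuous_apply j).comp (continuous_subtype_val.comp hf)

/-- By compactness and `overlap_self` there is a `δ`, uniform in time and space, such that stages
closer than `δ` are nowhere orthogonal. Lifts pass between such stages, so the times at which a lift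
exists form a clopen set. -/
theorem exists_lift_of_homotopy {X : Type*} [PseudoMetricSpace X] [CompactSpace X]
    {H : unitInterval × X → CP 1} (hH : Continuous H) {F : X → {v : Fin 2 → ℂ // v ≠ 0}}
    (hF : Continuous F) (hF1 : ∀ x, CP.rho 1 (F x) = H (1, x)) :
    ∃ F : X → {v : Fin 2 → ℂ // v ≠ 0}, Continuous F ∧ ∀ x, CP.rho 1 (F x) = H (0, x) := by
  have hc : Continuous fun z : unitInterval × unitInterval × X =>
      overlap (H (z.1, z.2.2)) (H (z.2.1, z.2.2)) :=
    continuous_overlap.comp (Continuous.prodMk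
      (hH.comp (by fun_prop)) (hH.comp (by fun_prop)))
  obtain ⟨δ, hδ, hδ'⟩ := Metric.uniformContinuous_iff.1
    (CompactSpace.uniformContinuous_of_continuous hc) 1 one_pos
  have step (s t : unitInterval) (hst : dist s t < δ)
      (hs : ∃ F : X → {v : Fin 2 → ℂ // v ≠ 0}, Continuous F ∧ ∀ x, CP.rho 1 (F x) = H (s, x)) :
      ∃ F : X → {v : Fin 2 → ℂ // v ≠ 0}, Continuous F ∧ ∀ x, CP.rho 1 (F x) = H (t, x) := by
    obtain ⟨F, hF, hF'⟩ := hs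
    refine exists_lift_of_overlap_ne_zero
      (g := fun x => H (t, x)) (hH.comp (by fun_prop)) hF fun x h => ?_
    have hd : dist (t, s, x) (s, s, x) < δ := by
      simpa only [Prod.dist_eq, dist_self, sup_lt_iff, and_self, dist_comm t s]
        using And.intro hst hδ
    have := hδ' hd
    rw [hF'] at h
    dsimp only at this
    rw [overlap_self, h, dist_zero_left, norm_one] at this
    exact lt_irrefl _ this
  have hS : IsClopen {s : unitInterval | ∃ F : X → {v : Fin 2 → ℂ // v ≠ 0},
      Continuous F ∧ ∀ x, CP.rho 1 (F x) = H (s, x)} := by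
    constructor
    · rw [← isOpen_compl_iff, Metric.isOpen_iff]
      exact fun s hs => ⟨δ, hδ, fun t ht ht' => hs (step t s ht ht')⟩
    · rw [Metric.isOpen_iff]
      exact fun s hs => ⟨δ, hδ, fun t ht => step s t (by rw [dist_comm]; exact ht) hs⟩
  exact (Set.eq_univ_iff_forall.1 (hS.eq_univ ⟨1, F, hF, hF1⟩)) 0

/-- A null-homotopic map from a compact metric space to `ℂℙ¹` lifts to `ℂ² ∖ {0}`. -/
theorem exists_lift_of_nullhomotopic {X : Type*} [PseudoMetricSpace X] [CompactSpace X]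
    {g : C(X, CP 1)} (hg : g.Nullhomotopic) :
    ∃ F : X → {v : Fin 2 → ℂ // v ≠ 0}, Continuous F ∧ ∀ x, CP.rho 1 (F x) = g x := by
  obtain ⟨y, ⟨H⟩⟩ := hg
  obtain ⟨v, hv⟩ := CP.rho_surjective 1 y
  obtain ⟨F, hF, hF'⟩ := exists_lift_of_homotopy H.continuous (F := fun _ => v)
    continuous_const (fun x => hv.trans (H.apply_one x).symm)
  exact ⟨F, hF, fun x => (hF' x).trans (H.apply_zero x)⟩

theorem not_nullhomotopic_stereoExt :
    ∃ φ : C(realSphere, CP 1), (∀ w : realSphere, φ w = stereoExt w.1) ∧ ¬ φ.Nullhomotopic :=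
  ⟨⟨_, continuous_stereoExt_sphere⟩, fun _ => rfl,
    fun h => not_exists_lift_stereoExt (exists_lift_of_nullhomotopic h)⟩

/-! ### Failure of approximation -/

theorem exists_pos_le_dist_of_isClosed {X : Type*} [T : TopologicalSpace X] [CompactSpace X]
    (D : MetricSpace X) (h : D.toPseudoMetricSpace.toUniformSpace.toTopologicalSpace = T)
    {O : Set (X × X)} (hO : IsClosed O) (hd : ∀ x, (x, x) ∉ O) :
    ∃ a : ℝ, 0 < a ∧ ∀ z ∈ O, a ≤ D.dist z.1 z.2 := by
  subst h
  exact hO.isCompact.exists_forall_le' (f := fun z : X × X => dist z.1 z.2)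
    continuous_dist.continuousOn fun z hz => dist_pos.2 fun e => hd z.1 (by
      have : z = (z.1, z.1) := Prod.ext rfl e.symm
      rwa [← this])

theorem continuous_polyMapNonzero_sphere (P : Fin 2 → MvPolynomial (Fin 3) ℂ)
    (hP : ∀ w ∈ realSphere, w ∉ criticalSet P) :
    Continuous fun w : realSphere => polyMapNonzero P ⟨w.1, hP w.1 w.2⟩ := by
  refine Continuous.subtype_mk (continuous_pi fun j => ?_) _
  exact (MvPolynomial.continuous_eval (P j)).comp continuous_subtype_val

theorem not_approximable_stereoExt (D : MetricSpace (CP 1))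
    (hD : D.toPseudoMetricSpace.toUniformSpace.toTopologicalSpace = CP.instTopologicalSpace 1) :
    ∃ β : ℝ, 0 < β ∧
      ∀ (P : Fin 2 → MvPolynomial (Fin 3) ℂ) (hP : ∀ w ∈ realSphere, w ∉ criticalSet P),
        ∃ w : realSphere, β < D.dist (ratMap P ⟨w.1, hP w.1 w.2⟩) (stereoExt w.1) := by
  obtain ⟨a, ha, h⟩ := exists_pos_le_dist_of_isClosed D hD
    (O := {z | overlap z.2 z.1 = 0})
    (isClosed_singleton.preimage (continuous_overlap.comp continuous_swap))
    (fun x hx => one_ne_zero ((overlap_self x).symm.trans hx))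
  -- Orthogonal lines are at least `a` apart. Halving leaves room for the non-strict bound `≤ a / 2`
  -- obtained by negation.
  refine ⟨a / 2, half_pos ha, fun P hP => ?_⟩
  by_contra! hw
  refine not_exists_lift_stereoExt (exists_lift_of_overlap_ne_zero continuous_stereoExt_sphere
    (continuous_polyMapNonzero_sphere P hP) fun w h0 => ?_)
  have h1 := h (ratMap P ⟨w.1, hP w.1 w.2⟩, stereoExt w.1) h0
  have h2 := hw w
  dsimp only at h1
  linarith

/-! ### Null-homotopy of polynomial mappings -/

theorem contDiff_eval_mvPolynomial {E : Type*} [NormedAddCommGroup E] [NormedSpace ℝ E] {n : ℕ}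
    {k : WithTop ℕ∞} (p : MvPolynomial (Fin n) ℂ) {f : E → Fin n → ℂ}
    (hf : ∀ i, ContDiff ℝ k fun x => f x i) :
    ContDiff ℝ k fun x => MvPolynomial.eval (f x) p := by
  induction p using MvPolynomial.induction_on with
  | C a => simpa using contDiff_const
  | add p q hp hq => simpa using hp.add hq
  | mul_X p i hp => simpa using hp.mul (hf i)

/-- Spherical coordinates on the real sphere. -/
def sphericalCoord (x : Fin 3 → ℝ) : Fin 3 → ℂ :=
  ![((Real.sin (x 1) * Real.cos (x 2) : ℝ) : ℂ), ((Real.sin (x 1) * Real.sin (x 2) : ℝ) : ℂ),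
    ((Real.cos (x 1) : ℝ) : ℂ)]

/-- The coordinate `x 0` does not enter `sphericalCoord`; it is reserved for the real scalar
multiplying `P`. -/
theorem exists_sphericalCoord_eq {w : Fin 3 → ℂ} (hw : w ∈ realSphere) (r : ℝ) :
    ∃ x : Fin 3 → ℝ, x 0 = r ∧ sphericalCoord x = w := by
  obtain ⟨a, b, c, h, rfl⟩ := hw
  have hc : -1 ≤ c ∧ c ≤ 1 := ⟨by nlinarith, by nlinarith⟩
  have hn : ‖(⟨a, b⟩ : ℂ)‖ = Real.sin (Real.arccos c) := by
    rw [Real.sin_arccos, Complex.norm_def, Complex.normSq_mk]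
    congr 1
    linarith
  refine ⟨![r, Real.arccos c, Complex.arg ⟨a, b⟩], rfl, ?_⟩
  simp only [sphericalCoord, Matrix.cons_val_one, Matrix.cons_val, ← hn,
    Complex.norm_mul_cos_arg, Complex.norm_mul_sin_arg, Real.cos_arccos hc.1 hc.2]

/-- The multiples `r P(w)` are the image of a `C¹` map from `ℝ³` to `ℂ² = ℝ⁴`, so they omit a dense
set. -/
theorem exists_smul_polyMap_ne (P : Fin 2 → MvPolynomial (Fin 3) ℂ) :
    ∃ u : Fin 2 → ℂ, u ≠ 0 ∧ ∀ w ∈ realSphere, ∀ r : ℝ, r • polyMap P w ≠ u := by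
  have h : ContDiff ℝ 1 fun x : Fin 3 → ℝ => x 0 • polyMap P (sphericalCoord x) := by
    rw [contDiff_pi]
    intro j
    refine ContDiff.smul (by fun_prop) (contDiff_eval_mvPolynomial _ fun i => ?_)
    fin_cases i <;> refine Complex.ofRealCLM.contDiff.comp ?_
    · exact (Real.contDiff_sin.comp (by fun_prop)).mul (Real.contDiff_cos.comp (by fun_prop))
    · exact (Real.contDiff_sin.comp (by fun_prop)).mul (Real.contDiff_sin.comp (by fun_prop))
    · exact Real.contDiff_cos.comp (by fun_prop)
  have hd := h.dense_compl_range_of_finrank_lt_finrank (by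
    rw [Module.finrank_pi, Module.finrank_pi_fintype]
    simp [Complex.finrank_real_complex])
  obtain ⟨u, hu⟩ := hd.nonempty
  have hu' (w) (hw : w ∈ realSphere) (r : ℝ) : r • polyMap P w ≠ u := by
    intro e
    obtain ⟨x, hx, hx'⟩ := exists_sphericalCoord_eq hw r
    exact hu ⟨x, by simp only [hx, hx', e]⟩
  refine ⟨u, ?_, hu'⟩
  -- The scalar `r = 0` is allowed, so `0` is not omitted.
  rintro rfl
  exact hu' ![1, 0, 0] ⟨1, 0, 0, by norm_num, by simp⟩ 0 (zero_smul _ _)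

theorem nullhomotopic_polyMapNonzero (P : Fin 2 → MvPolynomial (Fin 3) ℂ)
    (hP : ∀ w ∈ realSphere, w ∉ criticalSet P) :
    (⟨_, continuous_polyMapNonzero_sphere P hP⟩ :
      C(realSphere, {v : Fin 2 → ℂ // v ≠ 0})).Nullhomotopic := by
  obtain ⟨u, hu, h⟩ := exists_smul_polyMap_ne P
  have hc := continuous_polyMapNonzero_sphere P hP
  refine ⟨⟨u, hu⟩, ⟨⟨⟨fun x => ⟨(1 - (x.1 : ℝ)) • polyMap P x.2.1 + (x.1 : ℝ) • u, fun h0 => ?_⟩,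
    ?_⟩, fun w => ?_, fun w => ?_⟩⟩⟩
  · obtain ⟨⟨t, ht⟩, w, hw⟩ := x
    dsimp only at h0
    rcases eq_or_ne t 0 with rfl | ht0
    · refine hP w hw ?_
      change polyMap P w = 0
      simpa only [sub_zero, one_smul, zero_smul, add_zero] using h0
    -- A zero of the segment at `t ≠ 0` would give `u = -((1 - t) / t) P(w)`.
    · refine h w hw (-(t⁻¹ * (1 - t))) ?_
      rw [neg_smul, mul_smul, eq_neg_of_add_eq_zero_left h0, smul_neg, neg_neg, smul_smul,
        inv_mul_cancel₀ ht0, one_smul]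
  · have h1 : Continuous fun x : unitInterval × realSphere => polyMap P x.2.1 :=
      continuous_subtype_val.comp (hc.comp continuous_snd)
    exact Continuous.subtype_mk (by fun_prop) _
  · exact Subtype.ext (by simp [polyMapNonzero])
  · exact Subtype.ext (by simp)

theorem nullhomotopic_ratMap (P : Fin 2 → MvPolynomial (Fin 3) ℂ)
    (hP : ∀ w ∈ realSphere, w ∉ criticalSet P) :
    (∃ φ : C(realSphere, {v : Fin 2 → ℂ // v ≠ 0}),
      (∀ w : realSphere, φ w = polyMapNonzero P ⟨w.1, hP w.1 w.2⟩) ∧ φ.Nullhomotopic) ∧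
    (∃ φ : C(realSphere, CP 1),
      (∀ w : realSphere, φ w = ratMap P ⟨w.1, hP w.1 w.2⟩) ∧ φ.Nullhomotopic) :=
  ⟨⟨_, fun _ => rfl, nullhomotopic_polyMapNonzero P hP⟩,
    ⟨_, fun _ => rfl, (nullhomotopic_polyMapNonzero P hP).comp_right
      ⟨_, CP.continuous_rho 1⟩⟩⟩

/-! ### Vanishing of low homotopy groups of spheres -/

/-- A continuous map from a cube to `ℝⁿ`, of codimension at least two, is approximated by smooth
maps whose values are not proportional to a given vector. -/
theorem exists_approx_smul_ne {k n : ℕ} (hkn : k + 1 < n) {f : (Fin k → unitInterval) →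
    EuclideanSpace ℝ (Fin n)} (hf : Continuous f) (x : EuclideanSpace ℝ (Fin n))
    {ε : ℝ} (hε : 0 < ε) :
    ∃ q : (Fin k → unitInterval) → EuclideanSpace ℝ (Fin n), Continuous q ∧
      (∀ s, dist (q s) (f s) < ε) ∧ ∀ s, ∀ r : ℝ, q s ≠ r • x := by
  -- Clamping coordinates to `[0, 1]` extends `f` to `ℝᵏ`, where smooth approximation applies.
  obtain ⟨g, hg, hgf, -⟩ := Continuous.exists_contDiff_approx (E := Fin k → ℝ) 1
    (f := fun s => f fun i => Set.projIcc 0 1 zero_le_one (s i)) (ε := fun _ => ε / 2)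
    (hf.comp (continuous_pi fun i => continuous_projIcc.comp (continuous_apply i)))
    continuous_const fun _ => half_pos hε
  have h : ContDiff ℝ 1 fun z : ℝ × (Fin k → ℝ) => z.1 • x - g z.2 := by
    have := hg.comp (contDiff_snd (E := ℝ) (F := Fin k → ℝ))
    exact (contDiff_fst.smul contDiff_const).sub this
  have hd := h.dense_compl_range_of_finrank_lt_finrank (by
    simp [Module.finrank_prod]; omega)
  -- The differences `r x - g s` form a `C¹` image of `ℝ^(k+1)` in `ℝⁿ`. A small `e` outside it
  -- makes `g + e` miss the line of `x`.
  obtain ⟨e, he, he0⟩ := hd.exists_dist_lt 0 (half_pos hε)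
  refine ⟨fun s => g (fun i => s i) + e, ?_, fun s => ?_, fun s r h => ?_⟩
  · exact (hg.continuous.comp (by fun_prop)).add continuous_const
  · have h1 := hgf fun i => s i
    simp only [Set.projIcc_val] at h1
    calc dist (g (fun i => s i) + e) (f s)
        ≤ dist (g (fun i => s i) + e) (g fun i => s i) + dist (g fun i => s i) (f s) :=
          dist_triangle _ _ _
      _ < ε / 2 + ε / 2 := by
          refine add_lt_add ?_ h1
          rwa [dist_self_add_left, ← dist_zero_left]
      _ = ε := add_halves ε
  · exact he ⟨(r, fun i => s i), by simp only [← h, add_sub_cancel_left]⟩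

/-- A homotopy through nonzero vectors gives a homotopy of maps to the sphere by normalisation. -/
theorem homotopicRel_of_ne_zero {X : Type*} [TopologicalSpace X] {E : Type*}
    [NormedAddCommGroup E] [NormedSpace ℝ E] {f g : C(X, Metric.sphere (0 : E) 1)} {S : Set X}
    {H : unitInterval × X → E} (hH : Continuous H) (h : ∀ z, H z ≠ 0)
    (h0 : ∀ x, H (0, x) = f x) (h1 : ∀ x, ∃ r : ℝ, 0 < r ∧ H (1, x) = r • (g x : E))
    (hS : ∀ t, ∀ x ∈ S, H (t, x) = f x) : f.HomotopicRel g S := by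
  have hn (v : E) (r : ℝ) (hr : 0 < r) (hv : ‖v‖ = 1) : ‖r • v‖⁻¹ • r • v = v := by
    rw [norm_smul, hv, mul_one, Real.norm_of_nonneg hr.le, smul_smul, inv_mul_cancel₀ hr.ne',
      one_smul]
  have hn1 (v : E) (hv : ‖v‖ = 1) : ‖v‖⁻¹ • v = v := by rw [hv, inv_one, one_smul]
  have hf (x : X) : ‖(f x : E)‖ = 1 := mem_sphere_zero_iff_norm.1 (f x).2
  have hg (x : X) : ‖(g x : E)‖ = 1 := mem_sphere_zero_iff_norm.1 (g x).2
  refine ⟨⟨⟨⟨fun z => ⟨‖H z‖⁻¹ • H z, ?_⟩, ?_⟩, fun x => ?_, fun x => ?_⟩, fun t x hx => ?_⟩⟩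
  · rw [mem_sphere_zero_iff_norm, norm_smul, norm_inv, norm_norm,
      inv_mul_cancel₀ (norm_ne_zero_iff.2 (h z))]
  · exact Continuous.subtype_mk ((hH.norm.inv₀ fun z => norm_ne_zero_iff.2 (h z)).smul hH) _
  · refine Subtype.ext ?_
    change ‖H (0, x)‖⁻¹ • H (0, x) = f x
    rw [h0, hn1 _ (hf x)]
  · refine Subtype.ext ?_
    change ‖H (1, x)‖⁻¹ • H (1, x) = g x
    obtain ⟨r, hr, e⟩ := h1 x
    rw [e, hn _ _ hr (hg x)]
  · refine Subtype.ext ?_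
    change ‖H (t, x)‖⁻¹ • H (t, x) = f x
    rw [hS t x hx, hn1 _ (hf x)]

/-- A perturbation `F` of the loop that avoids the ray through `-x` joins `x` by segments missing
`0`, and normalisation returns to the sphere. -/
theorem genLoop_sphere_homotopic_const {k n : ℕ} (hkn : k + 1 < n)
    (x : Metric.sphere (0 : EuclideanSpace ℝ (Fin n)) 1)
    (f : GenLoop (Fin k) (Metric.sphere (0 : EuclideanSpace ℝ (Fin n)) 1) x) :
    GenLoop.Homotopic f GenLoop.const := by
  have hx : ‖(x : EuclideanSpace ℝ (Fin n))‖ = 1 := mem_sphere_zero_iff_norm.1 x.2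
  have hfn (s) : ‖(f.1 s : EuclideanSpace ℝ (Fin n))‖ = 1 := mem_sphere_zero_iff_norm.1 (f.1 s).2
  have hfc : Continuous fun s => (f.1 s : EuclideanSpace ℝ (Fin n)) :=
    continuous_subtype_val.comp f.1.continuous
  obtain ⟨q, hq, hqf, hqx⟩ := exists_approx_smul_ne hkn hfc x.1 (ε := 1 / 2) (by norm_num)
  -- The cutoff vanishes where `f = x`, which keeps the boundary fixed, and equals `1` at distance
  -- at least `1` from `x`.
  let lam (s : Fin k → unitInterval) : ℝ := min 1 (dist (f.1 s) x)
  have hlam : Continuous lam := by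
    have := f.1.continuous
    fun_prop
  have hlam0 (s) : 0 ≤ lam s := le_min zero_le_one dist_nonneg
  have hlam1 (s) : lam s ≤ 1 := min_le_left _ _
  have hlamb (s) (hs : s ∈ Cube.boundary (Fin k)) : lam s = 0 := by
    simp only [lam, f.2 s hs, dist_self, min_eq_right zero_le_one]
  let F (s : Fin k → unitInterval) : EuclideanSpace ℝ (Fin n) := f.1 s + lam s • (q s - f.1 s)
  have hF : Continuous F := hfc.add (hlam.smul (hq.sub hfc))
  have hsmall (s) (c : ℝ) (h0 : 0 ≤ c) (h1 : c ≤ 1) : ‖c • (q s - f.1 s)‖ < 1 / 2 := by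
    rw [norm_smul, Real.norm_of_nonneg h0, ← dist_eq_norm]
    calc c * dist (q s) (f.1 s) ≤ 1 * dist (q s) (f.1 s) := by gcongr
      _ < 1 / 2 := by rw [one_mul]; exact hqf s
  have hne (s) (c : ℝ) (h0 : 0 ≤ c) (h1 : c ≤ 1) : f.1 s + c • (q s - f.1 s) ≠ 0 := by
    intro h
    have h2 := hsmall s c h0 h1
    rw [← neg_eq_of_add_eq_zero_right h, norm_neg, hfn] at h2
    norm_num at h2
  have hFx (s) (c : ℝ) (hc : 0 ≤ c) : F s ≠ -(c • (x : EuclideanSpace ℝ (Fin n))) := by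
    intro h
    -- Far from `x`, `F = q` is off the whole line. Near `x`, `⟨f, x⟩ ≥ 1/2` and the perturbation is
    -- shorter than `1/2`, so `⟨F, x⟩ > 0`.
    rcases le_total 1 (dist (f.1 s) x) with hd | hd
    · apply hqx s (-c)
      rw [neg_smul, ← h]
      simp only [F, lam, min_eq_left hd, one_smul, add_sub_cancel]
    · have h1 : inner ℝ (F s) (x : EuclideanSpace ℝ (Fin n)) ≤ 0 := by
        rw [h, inner_neg_left, real_inner_smul_left, real_inner_self_eq_norm_sq, hx]
        linarith
      have h2 : (1 : ℝ) / 2 ≤ inner ℝ (f.1 s : EuclideanSpace ℝ (Fin n)) x := by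
        have h3 := norm_sub_sq_real (f.1 s : EuclideanSpace ℝ (Fin n)) x
        rw [hfn, hx, ← dist_eq_norm] at h3
        have h4 : dist (f.1 s : EuclideanSpace ℝ (Fin n)) x ≤ 1 := hd
        have h5 : dist (f.1 s : EuclideanSpace ℝ (Fin n)) x ^ 2 ≤ 1 :=
          pow_le_one₀ dist_nonneg h4
        linarith
      have h3 := abs_real_inner_le_norm (lam s • (q s - f.1 s)) (x : EuclideanSpace ℝ (Fin n))
      rw [hx, mul_one] at h3
      have h4 := hsmall s _ (hlam0 s) (hlam1 s)
      have h5 := neg_abs_le (inner ℝ (lam s • (q s - f.1 s)) (x : EuclideanSpace ℝ (Fin n)))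
      simp only [F, inner_add_left] at h1
      linarith
  have hFb (s) (hs : s ∈ Cube.boundary (Fin k)) : F s = x := by
    simp only [F, hlamb s hs, zero_smul, add_zero, f.2 s hs]
  have hF0 (s) : F s ≠ 0 := hne s _ (hlam0 s) (hlam1 s)
  have hFs (s) : ‖F s‖⁻¹ • F s ∈ Metric.sphere (0 : EuclideanSpace ℝ (Fin n)) 1 := by
    rw [mem_sphere_zero_iff_norm, norm_smul, norm_inv, norm_norm,
      inv_mul_cancel₀ (norm_ne_zero_iff.2 (hF0 s))]
  have hFc : Continuous fun s => ‖F s‖⁻¹ • F s :=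
    (hF.norm.inv₀ fun s => norm_ne_zero_iff.2 (hF0 s)).smul hF
  let F₁ : C(Fin k → unitInterval, Metric.sphere (0 : EuclideanSpace ℝ (Fin n)) 1) :=
    ⟨fun s => ⟨‖F s‖⁻¹ • F s, hFs s⟩, hFc.subtype_mk hFs⟩
  have hF₁ (s) : ∃ r : ℝ, 0 < r ∧ F s = r • (F₁ s : EuclideanSpace ℝ (Fin n)) := by
    have := norm_pos_iff.2 (hF0 s)
    exact ⟨‖F s‖, this, by simp only [F₁, ContinuousMap.coe_mk, smul_inv_smul₀ this.ne']⟩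
  have step₁ : f.1.HomotopicRel F₁ (Cube.boundary (Fin k)) := by
    refine homotopicRel_of_ne_zero
      (H := fun z => f.1 z.2 + ((z.1 : ℝ) * lam z.2) • (q z.2 - f.1 z.2)) ?_ (fun z => ?_)
      (fun s => by simp) (fun s => ?_) (fun t s hs => ?_)
    · have h1 := hfc.comp (continuous_snd (X := unitInterval))
      have h2 := hq.comp (continuous_snd (X := unitInterval))
      have h3 := hlam.comp (continuous_snd (X := unitInterval))
      have h4 : Continuous fun z : unitInterval × (Fin k → unitInterval) => (z.1 : ℝ) := by
        fun_prop
      exact h1.add ((h4.mul h3).smul (h2.sub h1))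
    · exact hne _ _ (mul_nonneg z.1.2.1 (hlam0 _)) (mul_le_one₀ z.1.2.2 (hlam0 _) (hlam1 _))
    · simpa only [Set.Icc.coe_one, one_mul] using hF₁ s
    · simp only [hlamb s hs, mul_zero, zero_smul, add_zero]
  have step₂ : F₁.HomotopicRel (ContinuousMap.const _ x) (Cube.boundary (Fin k)) := by
    refine homotopicRel_of_ne_zero
      (H := fun z => (1 - (z.1 : ℝ)) • (F₁ z.2 : EuclideanSpace ℝ (Fin n)) + (z.1 : ℝ) • x.1)
      ?_ (fun z => ?_) (fun s => by simp) (fun s => ⟨1, one_pos, by simp⟩) (fun t s hs => ?_)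
    · have h1 : Continuous fun z : unitInterval × (Fin k → unitInterval) => (F₁ z.2).1 :=
        continuous_subtype_val.comp (F₁.continuous.comp continuous_snd)
      fun_prop
    · obtain ⟨⟨t, ht⟩, s⟩ := z
      dsimp only
      intro h
      obtain ⟨r, hr, e⟩ := hF₁ s
      rcases ht.2.eq_or_lt with rfl | ht1
      · have : x.1 = 0 := by simpa using h
        rw [this, norm_zero] at hx
        exact zero_ne_one hx
      · have h1 : 0 < 1 - t := sub_pos.2 ht1
        refine hFx s (r * ((1 - t)⁻¹ * t)) (by have := ht.1; positivity) ?_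
        rw [e, mul_smul, ← smul_neg, mul_smul, ← smul_neg, ← eq_neg_of_add_eq_zero_left h,
          inv_smul_smul₀ h1.ne']
    · have h1 : (F₁ s).1 = x := by
        change ‖F s‖⁻¹ • F s = x
        rw [hFb s hs, hx, inv_one, one_smul]
      rw [h1, ← add_smul, sub_add_cancel, one_smul]
  exact step₁.trans step₂

theorem subsingleton_homotopyGroup_sphere {k n : ℕ} (hkn : k + 1 < n)
    (x : Metric.sphere (0 : EuclideanSpace ℝ (Fin n)) 1) :
    Subsingleton (HomotopyGroup.Pi k (Metric.sphere (0 : EuclideanSpace ℝ (Fin n)) 1) x) := by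
  refine ⟨fun a b => ?_⟩
  induction a using Quotient.inductionOn with
  | h a =>
    induction b using Quotient.inductionOn with
    | h b =>
      exact Quotient.sound ((genLoop_sphere_homotopic_const hkn x a).trans
        (genLoop_sphere_homotopic_const hkn x b).symm)

end

theorem mainTheorem3 :
    -- the real two-sphere is a rationally convex compact subset of `ℂ³`
    RationallyConvex realSphere ∧
    -- `g` is holomorphic on an open neighbourhood of the sphere
    (IsOpen slitDomain ∧ realSphere ⊆ slitDomain ∧ HolomorphicToCP stereoExt slitDomain) ∧
    -- both formulas for `g` are valid wherever their denominators do not vanish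
    (∀ w ∈ slitDomain,
      (sqrtQuad w + w 2 ≠ 0 ∨ sqrtQuad w - w 2 ≠ 0) ∧
      (sqrtQuad w + w 2 ≠ 0 →
        stereoExt w = CP.pointLeft ((w 0 + Complex.I * w 1) / (sqrtQuad w + w 2))) ∧
      (sqrtQuad w - w 2 ≠ 0 →
        stereoExt w = CP.pointRight ((w 0 - Complex.I * w 1) / (sqrtQuad w - w 2)))) ∧
    -- on the sphere, `g` is stereographic projection, which identifies the sphere with `ℂℙ¹`
    (∀ a b c : ℝ, a ^ 2 + b ^ 2 + c ^ 2 = 1 →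
      (c ≠ -1 → stereoExt ![(a : ℂ), (b : ℂ), (c : ℂ)] =
        CP.pointLeft (((a : ℂ) + Complex.I * b) / (1 + c))) ∧
      (c ≠ 1 → stereoExt ![(a : ℂ), (b : ℂ), (c : ℂ)] =
        CP.pointRight (((a : ℂ) - Complex.I * b) / (1 - c)))) ∧
    IsHomeomorph (fun w : realSphere => stereoExt w.1) ∧
    -- `π₂(S³) = 0`
    (∀ x : Metric.sphere (0 : EuclideanSpace ℝ (Fin 4)) 1,
      Subsingleton (HomotopyGroup.Pi 2 (Metric.sphere (0 : EuclideanSpace ℝ (Fin 4)) 1) x)) ∧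
    -- `P` and `ρ₁(P)` are null-homotopic on the sphere, if the critical set does not meet it
    (∀ (P : Fin 2 → MvPolynomial (Fin 3) ℂ) (hP : ∀ w ∈ realSphere, w ∉ criticalSet P),
      (∃ φ : C(realSphere, {v : Fin 2 → ℂ // v ≠ 0}),
        (∀ w : realSphere, φ w = polyMapNonzero P ⟨w.1, hP w.1 w.2⟩) ∧ φ.Nullhomotopic) ∧
      (∃ φ : C(realSphere, CP 1),
        (∀ w : realSphere, φ w = ratMap P ⟨w.1, hP w.1 w.2⟩) ∧ φ.Nullhomotopic)) ∧
    -- the restriction of `g` to the sphere is not null-homotopic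
    (∃ φ : C(realSphere, CP 1),
      (∀ w : realSphere, φ w = stereoExt w.1) ∧ ¬ φ.Nullhomotopic) ∧
    -- `g` cannot be uniformly approximated on the sphere by rational mappings, in any metric
    -- on `ℂℙ¹` which induces the topology
    (∀ D : MetricSpace (CP 1),
      D.toPseudoMetricSpace.toUniformSpace.toTopologicalSpace = CP.instTopologicalSpace 1 →
      ∃ β : ℝ, 0 < β ∧
        ∀ (P : Fin 2 → MvPolynomial (Fin 3) ℂ) (hP : ∀ w ∈ realSphere, w ∉ criticalSet P),
          ∃ w : realSphere, β < D.dist (ratMap P ⟨w.1, hP w.1 w.2⟩) (stereoExt w.1)) :=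
  ⟨rationallyConvex_realSphere,
    ⟨isOpen_slitDomain, realSphere_subset_slitDomain, holomorphicToCP_stereoExt⟩,
    fun _ hw => ⟨sqrtQuad_add_or_sub_ne_zero hw, stereoExt_eq_pointLeft, stereoExt_eq_pointRight⟩,
    fun _ _ _ h => ⟨stereoExt_sphere_left h, stereoExt_sphere_right h⟩,
    isHomeomorph_stereoExt,
    subsingleton_homotopyGroup_sphere (by norm_num),
    nullhomotopic_ratMap,
    not_nullhomotopic_stereoExt,
    not_approximable_stereoExt⟩
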